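/- A digraph is a finite set of vertices with a binary relation (its arcs) without loops; its order is its number of vertices. A homomorphism of digraphs is a map of vertices that sends arcs to arcs, and two digraphs are homomorphically equivalent if there are homomorphisms between them in both directions. The core of a digraph $G$ is the digraph of smallest order that is homomorphically equivalent to $G$ (it is unique up to isomorphism). The tensor product of a family $(D_i)_{i\in I}$ of digraphs has vertex set $\prod_{i\in I} V(D_i)$, with an arc from $(u_i)_i$ to $(v_i)_i$ exactly when there is an arc from $u_i$ to $v_i$ in $D_i$ for every $i\in I$. Proposition. There are a constant $c>0$ and an integer $n_0$ such that for every integer $n\ge n_0$ there is a finite nonempty family of digraphs, each of order at most $n$, whose tensor product has a core of order at least $$c\, n^{2^{\sqrt n}/\sqrt n}.$$ In other words, there are such families whose tensor product has a core of order $\Omega\left(n^{2^{\sqrt n}/\sqrt n}\right)$. -/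

import Mathlib

namespace Digraph

/-- `G → H`: there is a homomorphism, i.e. a map of vertices that sends arcs to arcs. -/
def HasHom {V W : Type} (G : Digraph V) (H : Digraph W) : Prop :=
  Nonempty (G.Adj →r H.Adj)

/-- Homomorphic equivalence: there are homomorphisms in both directions. -/
def HomEquiv {V W : Type} (G : Digraph V) (H : Digraph W) : Prop :=
  G.HasHom H ∧ H.HasHom G

/-- No vertex carries a loop. -/
def IsLoopless {V : Type} (G : Digraph V) : Prop :=
  ∀ v, ¬ G.Adj v v

/-- The tensor (categorical, direct) product of a family of digraphs: the vertices are the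
tuples of vertices, and there is an arc exactly when there is an arc in every coordinate. -/
def tensorProd {ι : Type} {V : ι → Type} (D : ∀ i, Digraph (V i)) : Digraph (∀ i, V i) where
  Adj u v := ∀ i, (D i).Adj (u i) (v i)

/-- `C` is the core of `G`: a finite digraph homomorphically equivalent to `G` with the smallest
number of vertices among all finite digraphs homomorphically equivalent to `G`.
(The core is unique up to isomorphism.) -/
def IsCoreOf {V W : Type} (C : Digraph W) (G : Digraph V) : Prop :=
  Finite W ∧ C.HomEquiv G ∧
    ∀ (U : Type) (_ : Finite U) (K : Digraph U), K.HomEquiv G → Nat.card W ≤ Nat.card U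

end Digraph

/-!
Attach to a set `A` of labels the pattern "a walk of fixed length starting at `v`, together with
chords from its second vertex to the positions labelled by `A`". Homomorphisms preserve patterns,
and a tuple starts a pattern in a tensor product exactly when each coordinate does. A layered
digraph on few vertices has, for prescribed sets `X b`, roots `b` starting exactly the patterns of
the sets `A` that do not contain `X b`: such a root guesses a label of `X b` outside `A`, and the
only position the guess has no arc to is the one carrying its label.

Distribute an antichain of label sets `X i b` among the factors, indexed by `i`. If two tuples of
roots differed at a coordinate `i` but were identified by a map to a digraph equivalent to the
product, then mapping back would produce a vertex of the `i`-th factor starting all the patterns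
`X i b`, which no root does. Hence the core distinguishes all tuples of roots, and there are doubly
exponentially many of them since the graphs of the functions `Fin k → Fin d` form an antichain of
size `d ^ k` on only `k * d` labels.
-/

/-- The pattern of `A` starts at `v`: there is a walk `w 0 → w 1 → ⋯ → w (M + 2)` with `w 0 = v`
that has a chord `w 1 → w (a + 3)` for every label `a ∈ A`. It is the homomorphism invariant that
separates the vertices of a product. -/
def HasPattern {V : Type*} {M : ℕ} (G : Digraph V) (A : Set (Fin M)) (v : V) : Prop :=
  ∃ w : Fin (M + 3) → V, w 0 = v ∧ (∀ j : Fin (M + 2), G.Adj (w j.castSucc) (w j.succ)) ∧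
    ∀ a ∈ A, G.Adj (w 1) (w a.succ.succ.succ)

theorem HasPattern.map {V W : Type*} {M : ℕ} {G : Digraph V} {H : Digraph W} {A : Set (Fin M)}
    {v : V} (h : HasPattern G A v) (f : G.Adj →r H.Adj) : HasPattern H A (f v) := by
  obtain ⟨w, rfl, hwalk, hchord⟩ := h
  exact ⟨f ∘ w, rfl, fun j => f.map_rel (hwalk j), fun a ha => f.map_rel (hchord a ha)⟩

theorem hasPattern_tensorProd_iff {ι : Type} {V : ι → Type} {D : ∀ i, Digraph (V i)} {M : ℕ}
    {A : Set (Fin M)} {v : ∀ i, V i} :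
    HasPattern (Digraph.tensorProd D) A v ↔ ∀ i, HasPattern (D i) A (v i) := by
  constructor
  · rintro ⟨w, rfl, hwalk, hchord⟩ i
    exact ⟨fun j => w j i, rfl, fun j => hwalk j i, fun a ha => hchord a ha i⟩
  · intro h
    choose w hstart hwalk hchord using h
    exact ⟨fun j i => w i j, funext hstart, fun j i => hwalk i j, fun a ha i => hchord i a ha⟩

/-- The vertices of a pattern-avoiding digraph: the roots, whose patterns are prescribed, one guess
for each label, and the positions on a path. The label `j` is carried by the position `j.succ`, so
the position `0` carries none. -/
inductive AvoidVertex (β : Type*) (M : ℕ)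
  | root (b : β)
  | guess (j : Fin M)
  | position (p : Fin (M + 1))

namespace AvoidVertex

variable {β : Type*} {M : ℕ}

/-- The sum of the types of roots, guesses and positions, for counting vertices. -/
def equivSum : AvoidVertex β M ≃ β ⊕ Fin M ⊕ Fin (M + 1) where
  toFun
    | root b => .inl b
    | guess j => .inr (.inl j)
    | position p => .inr (.inr p)
  invFun
    | .inl b => root b
    | .inr (.inl j) => guess j
    | .inr (.inr p) => position p
  left_inv := by rintro (b | j | p) <;> rfl
  right_inv := by rintro (b | j | p) <;> rfl

instance [Finite β] : Finite (AvoidVertex β M) :=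
  .of_equiv _ equivSum.symm

theorem card_eq [Finite β] : Nat.card (AvoidVertex β M) = Nat.card β + 2 * M + 1 := by
  rw [Nat.card_congr equivSum, Nat.card_sum, Nat.card_sum, Nat.card_fin, Nat.card_fin]
  ring

/-- The layer of a vertex; every arc of a pattern-avoiding digraph goes to a higher layer. -/
def level : AvoidVertex β M → Fin (M + 3)
  | root _ => 0
  | guess _ => 1
  | position p => p.succ.succ

theorem exists_eq_root_of_level_eq_zero {v : AvoidVertex β M} (h : v.level = 0) :
    ∃ b, v = root b := by
  rcases v with b | j | p
  · exact ⟨b, rfl⟩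
  · exact absurd h.symm Fin.zero_ne_one
  · exact absurd h p.succ.succ_ne_zero

theorem exists_eq_guess_of_level_eq_one {v : AvoidVertex β M} (h : v.level = 1) :
    ∃ j, v = guess j := by
  rcases v with b | j | p
  · exact absurd h Fin.zero_ne_one
  · exact ⟨j, rfl⟩
  · exact absurd h p.succ_succ_ne_one

theorem eq_position_of_level_eq {v : AvoidVertex β M} {p : Fin (M + 1)}
    (h : v.level = p.succ.succ) : v = position p := by
  rcases v with b | j | q
  · exact absurd h.symm p.succ.succ_ne_zero
  · exact absurd h.symm p.succ_succ_ne_one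
  · exact congrArg position (Fin.succ_injective _ (Fin.succ_injective _ h))

end AvoidVertex

open AvoidVertex

section Avoid

variable {β : Type*} {M : ℕ}

/-- The arcs of `avoidDigraph X`: a root `b` may guess any label in `X b`, and a guess has arcs to
all positions except the one carrying the guessed label. -/
inductive AvoidAdj (X : β → Set (Fin M)) : AvoidVertex β M → AvoidVertex β M → Prop
  | root_guess {b : β} {j : Fin M} (h : j ∈ X b) : AvoidAdj X (root b) (guess j)
  | guess_position {j : Fin M} {p : Fin (M + 1)} (h : p ≠ j.succ) :
      AvoidAdj X (guess j) (position p)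
  | position_position (j : Fin M) : AvoidAdj X (position j.castSucc) (position j.succ)

/-- The pattern-avoiding digraph, in which exactly the patterns of the sets not containing `X b`
start at the root `b`, and none start at the other vertices. -/
def avoidDigraph (X : β → Set (Fin M)) : Digraph (AvoidVertex β M) where
  Adj := AvoidAdj X

variable {X : β → Set (Fin M)}

theorem level_lt_level_of_adj {u v : AvoidVertex β M} (h : (avoidDigraph X).Adj u v) :
    u.level < v.level := by
  cases h with
  | root_guess => exact Fin.zero_lt_one
  | guess_position => exact Fin.succ_lt_succ_iff.2 (Fin.succ_pos _)
  | position_position j =>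
    exact Fin.succ_lt_succ_iff.2 (Fin.succ_lt_succ_iff.2 j.castSucc_lt_succ)

theorem avoidDigraph_isLoopless {β : Type} (X : β → Set (Fin M)) :
    (avoidDigraph X).IsLoopless :=
  fun _ h => lt_irrefl _ (level_lt_level_of_adj h)

theorem level_walk_eq {w : Fin (M + 3) → AvoidVertex β M}
    (hw : ∀ j : Fin (M + 2), (avoidDigraph X).Adj (w j.castSucc) (w j.succ)) (j : Fin (M + 3)) :
    (w j).level = j := by
  have hmono : StrictMono (level ∘ w) :=
    Fin.strictMono_iff_lt_succ.2 fun j => level_lt_level_of_adj (hw j)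
  exact hmono.apply_eq

theorem hasPattern_root {A : Set (Fin M)} {b : β} (h : ¬ X b ⊆ A) :
    HasPattern (avoidDigraph X) A (root b) := by
  obtain ⟨j, hjX, hjA⟩ := Set.not_subset.1 h
  refine ⟨Fin.cons (root b) (Fin.cons (guess j) position), rfl, fun i => ?_, fun a ha => ?_⟩
  · cases i using Fin.cases with
    | zero => exact .root_guess hjX
    | succ i =>
      cases i using Fin.cases with
      | zero => exact .guess_position (Fin.succ_ne_zero j).symm
      | succ i => exact .position_position i
  · exact .guess_position fun e => hjA (Fin.succ_injective _ e ▸ ha)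

theorem HasPattern.exists_eq_root {A : Set (Fin M)} {v : AvoidVertex β M}
    (h : HasPattern (avoidDigraph X) A v) : ∃ b, v = root b ∧ ¬ X b ⊆ A := by
  obtain ⟨w, rfl, hwalk, hchord⟩ := h
  have hlevel := level_walk_eq hwalk
  obtain ⟨b, hb⟩ := exists_eq_root_of_level_eq_zero (hlevel 0)
  obtain ⟨j, hj⟩ := exists_eq_guess_of_level_eq_one (hlevel 1)
  refine ⟨b, hb, fun hsub => ?_⟩
  have hjX : j ∈ X b := by
    have harc : AvoidAdj X (w 0) (w 1) := hwalk 0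
    rw [hb, hj] at harc
    cases harc
    assumption
  have hmiss : AvoidAdj X (w 1) (w j.succ.succ.succ) := hchord j (hsub hjX)
  rw [hj, eq_position_of_level_eq (hlevel j.succ.succ.succ)] at hmiss
  cases hmiss
  contradiction

theorem not_forall_hasPattern [Nonempty β] (X : β → Set (Fin M)) (v : AvoidVertex β M) :
    ¬ ∀ b, HasPattern (avoidDigraph X) (X b) v := by
  intro h
  obtain ⟨b, rfl, -⟩ := (h (Classical.arbitrary β)).exists_eq_root
  obtain ⟨b', hbb', hb'⟩ := (h b).exists_eq_root
  cases hbb'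
  exact hb' subset_rfl

end Avoid

section Product

variable {ι β W : Type} {M : ℕ} {X : ι × β → Set (Fin M)} {C : Digraph W}

/-- The tensor product of the pattern-avoiding digraphs whose roots are prescribed by the rows of
`X`. -/
abbrev avoidProd (X : ι × β → Set (Fin M)) : Digraph (ι → AvoidVertex β M) :=
  Digraph.tensorProd fun i => avoidDigraph fun b => X (i, b)

theorem hasPattern_avoidProd_root (hX : Pairwise fun p q => ¬ X p ⊆ X q) {S : ι → β} {i : ι} {b : β}
    (hb : S i ≠ b) : HasPattern (avoidProd X) (X (i, b)) fun j => root (S j) :=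
  hasPattern_tensorProd_iff.2 fun j => hasPattern_root <| hX fun e => by
    cases e
    exact hb rfl

theorem injective_hom_root (hX : Pairwise fun p q => ¬ X p ⊆ X q)
    (f : (avoidProd X).Adj →r C.Adj) (g : C.Adj →r (avoidProd X).Adj) :
    Function.Injective fun S : ι → β => f fun i => root (S i) := by
  intro S T (hST : f _ = f _)
  by_contra hne
  obtain ⟨i, hi⟩ := Function.ne_iff.1 hne
  have : Nonempty β := ⟨S i⟩
  refine not_forall_hasPattern (fun b => X (i, b)) (g (f fun j => root (S j)) i) fun b => ?_
  refine hasPattern_tensorProd_iff.1 (HasPattern.map ?_ g) i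
  by_cases hb : S i = b
  · rw [hST]
    exact (hasPattern_avoidProd_root hX (hb ▸ hi.symm)).map f
  · exact (hasPattern_avoidProd_root hX hb).map f

theorem card_pow_card_le_of_homEquiv [Finite ι] [Finite W]
    (hX : Pairwise fun p q => ¬ X p ⊆ X q) (h : C.HomEquiv (avoidProd X)) :
    Nat.card β ^ Nat.card ι ≤ Nat.card W := by
  obtain ⟨⟨g⟩, ⟨f⟩⟩ := h
  rw [← Nat.card_fun]
  exact Nat.card_le_card_of_injective _ (injective_hom_root hX f g)

end Product

theorem exists_isCoreOf {V : Type} [Finite V] (G : Digraph V) :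
    ∃ (W : Type) (C : Digraph W), C.IsCoreOf G := by
  classical
  have hex : ∃ k : ℕ, ∃ (W : Type) (_ : Finite W) (C : Digraph W),
      C.HomEquiv G ∧ Nat.card W = k :=
    ⟨_, V, inferInstance, G, ⟨⟨RelHom.id _⟩, ⟨RelHom.id _⟩⟩, rfl⟩
  obtain ⟨W, hW, C, hC, hcard⟩ := Nat.find_spec hex
  exact ⟨W, C, hW, hC, fun U hU K hK => hcard ▸ Nat.find_min' hex ⟨U, hU, K, hK, rfl⟩⟩

theorem eq_of_graphOn_univ_subset {α γ : Type*} {f g : α → γ}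
    (h : Set.univ.graphOn f ⊆ Set.univ.graphOn g) : f = g := by
  funext a
  have hmem : (a, f a) ∈ Set.univ.graphOn g := h (Set.mem_graphOn.2 ⟨Set.mem_univ a, rfl⟩)
  exact (Set.mem_graphOn.1 hmem).2.symm

theorem exists_pairwise_not_subset (k d : ℕ) :
    ∃ X : (Fin k → Fin d) × Fin d → Set (Fin ((k + 1) * d)), Pairwise fun p q => ¬ X p ⊆ X q := by
  refine ⟨fun p => finProdFinEquiv '' Set.univ.graphOn (Fin.cons p.2 p.1 : Fin (k + 1) → Fin d),
    fun p q hpq hsub => hpq ?_⟩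
  have hcons := eq_of_graphOn_univ_subset
    ((Set.image_subset_image_iff finProdFinEquiv.injective).1 hsub)
  obtain ⟨hhead, htail⟩ := Fin.cons_injective2 hcons
  exact Prod.ext htail hhead

theorem exists_isCoreOf_tensorProd_card_ge (k d : ℕ) :
    ∃ D : (Fin k → Fin d) → Digraph (AvoidVertex (Fin d) ((k + 1) * d)),
      (∀ s, (D s).IsLoopless) ∧ ∃ (W : Type) (C : Digraph W),
        C.IsCoreOf (Digraph.tensorProd D) ∧ d ^ d ^ k ≤ Nat.card W := by
  obtain ⟨X, hX⟩ := exists_pairwise_not_subset k d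
  obtain ⟨W, C, hC⟩ := exists_isCoreOf (avoidProd X)
  have : Finite W := hC.1
  refine ⟨_, fun s => avoidDigraph_isLoopless _, W, C, hC, ?_⟩
  simpa only [Nat.card_fun, Nat.card_fin] using card_pow_card_le_of_homEquiv hX hC.2.1

theorem eventually_le_rpow_sqrt {b : ℝ} (hb : 1 < b) : ∀ᶠ x : ℝ in Filter.atTop, x ≤ b ^ √x := by
  have hlog := (isLittleO_log_rpow_atTop (r := 1 / 2) (by norm_num)).bound (Real.log_pos hb)
  filter_upwards [hlog, Filter.eventually_gt_atTop 0] with x hx hpos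
  rw [← Real.sqrt_eq_rpow, Real.norm_of_nonneg (Real.sqrt_nonneg _), mul_comm] at hx
  exact (Real.le_rpow_iff_log_le hpos (one_pos.trans hb)).2 ((Real.le_norm_self _).trans hx)

theorem rpow_div_le_rpow_of_le_rpow {x b s t : ℝ} (hx : 0 ≤ x) (hb : 0 ≤ b) (hs : 0 < s)
    (ht : 0 ≤ t) (h : x ≤ b ^ s) : x ^ (t / s) ≤ b ^ t :=
  calc x ^ (t / s) ≤ (b ^ s) ^ (t / s) := Real.rpow_le_rpow hx h (by positivity)
    _ = b ^ t := by rw [← Real.rpow_mul hb, mul_div_cancel₀ _ hs.ne']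

theorem rpow_rpow_le_pow_pow_ceil {m : ℕ} (hm : 1 ≤ m) (y : ℝ) :
    (m : ℝ) ^ (m : ℝ) ^ y ≤ (m ^ m ^ ⌈y⌉₊ : ℕ) := by
  have hm' : (1 : ℝ) ≤ m := by exact_mod_cast hm
  rw [Nat.cast_pow, ← Real.rpow_natCast (m : ℝ) (m ^ ⌈y⌉₊), Nat.cast_pow,
    ← Real.rpow_natCast (m : ℝ) ⌈y⌉₊]
  gcongr
  exact Nat.le_ceil y

theorem four_mul_ceil_sqrt_add_seven_le {x : ℝ} (hx : 49 ≤ x) : 4 * ⌈√x⌉₊ + 7 ≤ x := by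
  have hsqrt : 7 ≤ √x := Real.le_sqrt_of_sq_le (by linarith)
  have hceil := Nat.ceil_lt_add_one (Real.sqrt_nonneg x)
  have hsq := Real.sq_sqrt (by linarith : 0 ≤ x)
  nlinarith

theorem mainTheorem7 :
    ∃ c : ℝ, 0 < c ∧ ∀ᶠ n : ℕ in Filter.atTop,
      ∃ (ι : Type) (_ : Finite ι) (_ : Nonempty ι)
        (V : ι → Type) (_ : ∀ i, Finite (V i)) (D : ∀ i, Digraph (V i)),
        (∀ i, (D i).IsLoopless) ∧
        (∀ i, Nat.card (V i) ≤ n) ∧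
        ∃ (W : Type) (C : Digraph W), C.IsCoreOf (Digraph.tensorProd D) ∧
          c * (n : ℝ) ^ ((2 : ℝ) ^ Real.sqrt (n : ℝ) / Real.sqrt (n : ℝ)) ≤ (Nat.card W : ℝ) := by
  refine ⟨1, one_pos, ?_⟩
  filter_upwards [tendsto_natCast_atTop_atTop.eventually (eventually_le_rpow_sqrt one_lt_two),
    Filter.eventually_ge_atTop 49] with n hn hn49
  obtain ⟨D, hloop, W, C, hC, hcard⟩ := exists_isCoreOf_tensorProd_card_ge ⌈√(n : ℝ)⌉₊ 2
  refine ⟨_, inferInstance, inferInstance, _, fun _ => inferInstance, D, hloop, fun _ => ?_,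
    W, C, hC, ?_⟩
  · have hord : 4 * ⌈√(n : ℝ)⌉₊ + 7 ≤ n := by
      exact_mod_cast four_mul_ceil_sqrt_add_seven_le (by exact_mod_cast hn49 : (49 : ℝ) ≤ n)
    rw [AvoidVertex.card_eq, Nat.card_fin]
    omega
  · have hsqrt : 0 < √(n : ℝ) := Real.sqrt_pos.2 (by exact_mod_cast (by omega : 0 < n))
    calc 1 * (n : ℝ) ^ ((2 : ℝ) ^ √(n : ℝ) / √(n : ℝ))
        ≤ 2 ^ (2 : ℝ) ^ √(n : ℝ) := by
          rw [one_mul]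
          exact rpow_div_le_rpow_of_le_rpow n.cast_nonneg zero_le_two hsqrt (by positivity) hn
      _ ≤ (2 ^ 2 ^ ⌈√(n : ℝ)⌉₊ : ℕ) := rpow_rpow_le_pow_pow_ceil one_le_two _
      _ ≤ Nat.card W := Nat.cast_le.2 hcard
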